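/- Consider the planar system $\dot x = xy - x^2y$, $\dot y = y^2+\frac14x^3+\frac14x^2+\frac14x+\frac14$, with first integral $$H(x,y)=\tfrac1{16}x^{-2}(x-1)^2(x^2+2x+1+4y^2).$$ For $h>0$ let $\Gamma_h=\{(x,y): x<0,\ H(x,y)=h\}$, the periodic orbit around the centre $(-1,0)$. It is a closed curve admitting a regular $C^1$ parametrization that runs through it exactly once in the direction of the flow (counterclockwise). With this orientation put $$I_{i,j}(h)=\oint_{\Gamma_h}(x-1)x^{i-3}y^j\,dx .$$ Let $K(k)=\int_0^{\pi/2}\frac{d\theta}{\sqrt{1-k^2\sin^2\theta}}$ and $E(k)=\int_0^{\pi/2}\sqrt{1-k^2\sin^2\theta}\,d\theta$ be the complete elliptic integrals of the first and second kind. Then, for every $h>0$, $$I_{1,1}(h)=\frac{16h+2}{\sqrt{8h+1+4\sqrt{4h^2+h}}}\,K(k)-\frac{2}{\sqrt{8h+1-4\sqrt{4h^2+h}}}\,E(k),$$ $$I_{3,1}(h)=\frac{16h+2}{3\sqrt{8h+1-4\sqrt{4h^2+h}}}\,E(k)-\frac{16h+2-8\sqrt{4h^2+h}}{3\sqrt{8h+1-4\sqrt{4h^2+h}}}\,K(k),$$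 $$I_{0,1}(h)=-4\pi h,\qquad I_{2,1}(h)=-4\pi h,$$ where $$k=2\sqrt2\,\sqrt{\frac{\sqrt{4h^2+h}}{8h+1+4\sqrt{4h^2+h}}},\qquad 0<k<1 .$$ -/

import Mathlib

open Set Real

/-- The first integral `H(x,y) = x⁻² (x-1)² (x² + 2x + 1 + 4y²) / 16` of the unperturbed system. -/
noncomputable def firstIntegral (p : ℝ × ℝ) : ℝ :=
  (1 / 16) * (p.1 ^ 2)⁻¹ * (p.1 - 1) ^ 2 * (p.1 ^ 2 + 2 * p.1 + 1 + 4 * p.2 ^ 2)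

/-- The unperturbed vector field
`x' = x y - x² y`, `y' = y² + x³/4 + x²/4 + x/4 + 1/4`. -/
noncomputable def vectorField (p : ℝ × ℝ) : ℝ × ℝ :=
  (p.1 * p.2 - p.1 ^ 2 * p.2,
    p.2 ^ 2 + p.1 ^ 3 / 4 + p.1 ^ 2 / 4 + p.1 / 4 + 1 / 4)

/-- The periodic orbit `Γ_h` around the centre `(-1, 0)`: the part of the level set `H = h` lying in
the half plane `x < 0`, which contains the centre. (The singular line `x = 0` of `H` separates it
from the rest of the level set, which is unbounded and lies in `x > 0`.) -/
def orbit (h : ℝ) : Set (ℝ × ℝ) :=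
  {p | p.1 < 0 ∧ firstIntegral p = h}

/-- `γ`, restricted to `[a, b]`, is a regular `C¹` parametrization of the closed curve `Γ_h` which
runs through it exactly once, in the direction of the flow (that is, counterclockwise). -/
structure IsOrbitParam (h a b : ℝ) (γ : ℝ → ℝ × ℝ) : Prop where
  lt : a < b
  contDiffOn : ContDiffOn ℝ 1 γ (Icc a b)
  closed : γ a = γ b
  injOn : InjOn γ (Ico a b)
  image_eq : γ '' Icc a b = orbit h
  flow : ∀ t ∈ Icc a b, ∃ c : ℝ, 0 < c ∧ derivWithin γ (Icc a b) t = c • vectorField (γ t)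

/-- The line integral `∫ (x-1) x^{i-3} y^j dx` along the curve `γ` on `[a, b]`. It is
`I_{i,j}(h)` when `γ` parametrizes `Γ_h`. -/
noncomputable def orbitIntegral (i j : ℕ) (a b : ℝ) (γ : ℝ → ℝ × ℝ) : ℝ :=
  ∫ t in a..b, ((γ t).1 - 1) * (γ t).1 ^ ((i : ℤ) - 3) * (γ t).2 ^ j *
    (derivWithin γ (Icc a b) t).1

/-- The complete elliptic integral of the first kind, with modulus `k`. -/
noncomputable def ellipticK (k : ℝ) : ℝ :=
  ∫ θ in (0 : ℝ)..(π / 2), 1 / √(1 - k ^ 2 * sin θ ^ 2)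

/-- The complete elliptic integral of the second kind, with modulus `k`. -/
noncomputable def ellipticE (k : ℝ) : ℝ :=
  ∫ θ in (0 : ℝ)..(π / 2), √(1 - k ^ 2 * sin θ ^ 2)

/-- The modulus `k(h)`. -/
noncomputable def modulus (h : ℝ) : ℝ :=
  2 * √2 * √(√(4 * h ^ 2 + h) / (8 * h + 1 + 4 * √(4 * h ^ 2 + h)))

/-! In the coordinate `z = (x - 1/x) / 2 + i y (1 - 1/x)` of the half plane `x < 0` the first
integral is `H = |z|² / 4` and the flow is the rotation `dz/dt = i (x² + 1) z / 2`. Every admissible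
parametrization of `Γ_h` therefore runs once around the circle `|z| = 2√h`, and the integrals
`I_{i,j}(h)` become integrals over the angle `φ`, with `x` the negative root of
`x - 1/x = 4√h cos φ`.

The reflections `φ ↦ 2π - φ` and `φ ↦ π - φ`, the second of which replaces `x` by `1/x`, fold the
circle onto `[0, π/2]`. For `j = 1` only the sums `x^(i-1) + x^(1-i)` remain; they are polynomials
in `√(1 + 4h cos² φ)`, which gives elliptic integrals of modulus `κ = 2√h / √(4h + 1)`. Landen's
transformation turns these into elliptic integrals of modulus `k(h) = 2√κ / (1 + κ)`. -/

/-! ### Complete elliptic integrals and Landen's transformation -/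

lemma integral_zero_eq_integral_add_reflect {E : Type*} [NormedAddCommGroup E] [NormedSpace ℝ E]
    {f : ℝ → E} (hf : Continuous f) (c : ℝ) :
    ∫ x in (0 : ℝ)..c, f x = ∫ x in (0 : ℝ)..(c / 2), (f x + f (c - x)) := by
  rw [intervalIntegral.integral_add (hf.intervalIntegrable _ _)
      (Continuous.intervalIntegrable (by fun_prop) _ _),
    intervalIntegral.integral_comp_sub_left, sub_half, sub_zero,
    intervalIntegral.integral_add_adjacent_intervals (hf.intervalIntegrable _ _)
      (hf.intervalIntegrable _ _)]

/-- Legendre's delta `Δ(κ, φ) = √(1 - κ² sin² φ)`, the radical in the integrals `K(κ)` and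
`E(κ)`. -/
noncomputable def ellipticDelta (κ φ : ℝ) : ℝ := √(1 - κ ^ 2 * sin φ ^ 2)

/-- The substitution `t = φ + arcsin (κ sin φ)` of Landen's transformation. -/
noncomputable def landenAngle (κ φ : ℝ) : ℝ := φ + arcsin (κ * sin φ)

section Elliptic

variable {κ : ℝ}

lemma abs_mul_sin_lt_one (hκ : |κ| < 1) (φ : ℝ) : |κ * sin φ| < 1 := by
  rw [abs_mul]
  exact mul_lt_one_of_nonneg_of_lt_one_left (abs_nonneg κ) hκ (abs_sin_le_one φ)

lemma mul_sin_mem_Ioo (hκ : |κ| < 1) (φ : ℝ) : κ * sin φ ∈ Ioo (-1) 1 :=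
  abs_lt.1 (abs_mul_sin_lt_one hκ φ)

lemma cos_arcsin_mul_sin (κ φ : ℝ) : cos (arcsin (κ * sin φ)) = ellipticDelta κ φ := by
  rw [cos_arcsin, mul_pow, ellipticDelta]

lemma one_sub_sq_mul_sin_sq_pos (hκ : |κ| < 1) (φ : ℝ) : 0 < 1 - κ ^ 2 * sin φ ^ 2 := by
  rw [← mul_pow, sub_pos, sq_lt_one_iff_abs_lt_one]
  exact abs_mul_sin_lt_one hκ φ

lemma ellipticDelta_pos (hκ : |κ| < 1) (φ : ℝ) : 0 < ellipticDelta κ φ :=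
  Real.sqrt_pos.2 (one_sub_sq_mul_sin_sq_pos hκ φ)

lemma ellipticDelta_sq (hκ : |κ| < 1) (φ : ℝ) :
    ellipticDelta κ φ ^ 2 = 1 - κ ^ 2 * sin φ ^ 2 :=
  Real.sq_sqrt (one_sub_sq_mul_sin_sq_pos hκ φ).le

lemma ellipticDelta_pi_sub (κ φ : ℝ) : ellipticDelta κ (π - φ) = ellipticDelta κ φ := by
  rw [ellipticDelta, sin_pi_sub, ellipticDelta]

@[fun_prop]
lemma continuous_ellipticDelta (κ : ℝ) : Continuous (ellipticDelta κ) := by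
  unfold ellipticDelta
  fun_prop

lemma continuous_one_div_ellipticDelta (hκ : |κ| < 1) :
    Continuous fun φ => 1 / ellipticDelta κ φ :=
  continuous_const.div (continuous_ellipticDelta κ) fun φ => (ellipticDelta_pos hκ φ).ne'

lemma ellipticDelta_add_mul_cos_pos (hκ : |κ| < 1) (φ : ℝ) :
    0 < ellipticDelta κ φ + κ * cos φ := by
  have habs : |κ * cos φ| < ellipticDelta κ φ := by
    refine abs_lt_of_sq_lt_sq ?_ (ellipticDelta_pos hκ φ).le
    rw [ellipticDelta_sq hκ, mul_pow, cos_sq']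
    linarith [(sq_lt_one_iff_abs_lt_one κ).2 hκ]
  linarith [neg_abs_le (κ * cos φ)]

lemma hasDerivAt_ellipticDelta (hκ : |κ| < 1) (φ : ℝ) :
    HasDerivAt (ellipticDelta κ) (-(κ ^ 2 * sin φ * cos φ) / ellipticDelta κ φ) φ := by
  have hradicand : HasDerivAt (fun φ => 1 - κ ^ 2 * sin φ ^ 2)
      (-(κ ^ 2 * (2 * sin φ * cos φ))) φ := by
    simpa using (((hasDerivAt_sin φ).pow 2).const_mul (κ ^ 2)).const_sub 1
  refine (hradicand.sqrt (one_sub_sq_mul_sin_sq_pos hκ φ).ne').congr_deriv ?_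
  rw [← ellipticDelta]
  ring

lemma hasDerivAt_landenAngle (hκ : |κ| < 1) (φ : ℝ) :
    HasDerivAt (landenAngle κ) ((ellipticDelta κ φ + κ * cos φ) / ellipticDelta κ φ) φ := by
  obtain ⟨hgt, hlt⟩ := mul_sin_mem_Ioo hκ φ
  refine ((hasDerivAt_id φ).add ((hasDerivAt_arcsin hgt.ne' hlt.ne).comp φ
    ((hasDerivAt_sin φ).const_mul κ))).congr_deriv ?_
  rw [← cos_arcsin, cos_arcsin_mul_sin, add_div, div_self (ellipticDelta_pos hκ φ).ne']
  ring

lemma sqrt_landenAngle (hκ : |κ| < 1) (φ : ℝ) :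
    √(1 + κ ^ 2 + 2 * κ * cos (landenAngle κ φ)) = ellipticDelta κ φ + κ * cos φ := by
  obtain ⟨hgt, hlt⟩ := mul_sin_mem_Ioo hκ φ
  rw [Real.sqrt_eq_iff_mul_self_eq_of_pos (ellipticDelta_add_mul_cos_pos hκ φ), landenAngle,
    cos_add, cos_arcsin_mul_sin, sin_arcsin hgt.le hlt.le]
  linear_combination ellipticDelta_sq hκ φ + κ ^ 2 * sin_sq_add_cos_sq φ

lemma integral_comp_landenAngle (hκ : |κ| < 1) (g : ℝ → ℝ) :
    ∫ t in (0 : ℝ)..π, g √(1 + κ ^ 2 + 2 * κ * cos t) =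
      ∫ φ in (0 : ℝ)..π, g (ellipticDelta κ φ + κ * cos φ) *
        ((ellipticDelta κ φ + κ * cos φ) / ellipticDelta κ φ) := by
  have hderiv := hasDerivAt_landenAngle hκ
  have hsubst := intervalIntegral.integral_comp_mul_deriv_of_deriv_nonneg
    (a := 0) (b := π) (g := fun t => g √(1 + κ ^ 2 + 2 * κ * cos t))
    (fun φ _ => (hderiv φ).continuousAt.continuousWithinAt)
    (fun φ _ => hderiv φ)
    fun φ _ => (div_pos (ellipticDelta_add_mul_cos_pos hκ φ) (ellipticDelta_pos hκ φ)).le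
  have hzero : landenAngle κ 0 = 0 := by simp [landenAngle]
  have hpi : landenAngle κ π = π := by simp [landenAngle]
  rw [hzero, hpi] at hsubst
  simpa only [Function.comp_apply, sqrt_landenAngle hκ] using hsubst.symm

lemma ellipticDelta_landen (hκ : 0 ≤ κ) (θ : ℝ) :
    ellipticDelta (2 * √κ / (1 + κ)) θ = √(1 + κ ^ 2 + 2 * κ * cos (2 * θ)) / (1 + κ) := by
  have hpos : 0 < 1 + κ := by positivity
  rw [ellipticDelta, eq_div_iff hpos.ne', ← Real.sqrt_sq hpos.le, ← Real.sqrt_mul' _ (sq_nonneg _),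
    Real.sqrt_sq hpos.le, div_pow, mul_pow, Real.sq_sqrt hκ, cos_two_mul, cos_sq']
  congr 1
  field_simp
  ring

lemma integral_comp_ellipticDelta_landen (hκ₀ : 0 ≤ κ) (hκ₁ : κ < 1) (g : ℝ → ℝ) :
    ∫ θ in (0 : ℝ)..(π / 2), g (ellipticDelta (2 * √κ / (1 + κ)) θ) =
      2⁻¹ * ∫ φ in (0 : ℝ)..π, g ((ellipticDelta κ φ + κ * cos φ) / (1 + κ)) *
        ((ellipticDelta κ φ + κ * cos φ) / ellipticDelta κ φ) := by
  simp only [ellipticDelta_landen hκ₀]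
  rw [← integral_comp_landenAngle (abs_lt.2 ⟨by linarith, hκ₁⟩) fun x => g (x / (1 + κ)),
    intervalIntegral.integral_comp_mul_left
      (fun t => g (√(1 + κ ^ 2 + 2 * κ * cos t) / (1 + κ))) two_ne_zero,
    mul_zero, mul_div_cancel₀ _ two_ne_zero, smul_eq_mul]

lemma ellipticK_eq_integral (κ : ℝ) :
    ellipticK κ = ∫ φ in (0 : ℝ)..(π / 2), 1 / ellipticDelta κ φ := rfl

lemma ellipticE_eq_integral (κ : ℝ) :
    ellipticE κ = ∫ φ in (0 : ℝ)..(π / 2), ellipticDelta κ φ := rfl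

theorem ellipticK_landen (hκ₀ : 0 ≤ κ) (hκ₁ : κ < 1) :
    ellipticK (2 * √κ / (1 + κ)) = (1 + κ) * ellipticK κ := by
  have hκ : |κ| < 1 := abs_lt.2 ⟨by linarith, hκ₁⟩
  have hintegrand (φ : ℝ) : 1 / ((ellipticDelta κ φ + κ * cos φ) / (1 + κ)) *
      ((ellipticDelta κ φ + κ * cos φ) / ellipticDelta κ φ) =
        (1 + κ) * (1 / ellipticDelta κ φ) := by
    have := (ellipticDelta_add_mul_cos_pos hκ φ).ne'
    field_simp
  rw [ellipticK_eq_integral, integral_comp_ellipticDelta_landen hκ₀ hκ₁ fun x => 1 / x]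
  simp only [hintegrand]
  rw [intervalIntegral.integral_const_mul,
    integral_zero_eq_integral_add_reflect (continuous_one_div_ellipticDelta hκ)]
  simp only [ellipticDelta_pi_sub, ← two_mul, intervalIntegral.integral_const_mul,
    ← ellipticK_eq_integral]
  ring

theorem ellipticE_landen (hκ₀ : 0 ≤ κ) (hκ₁ : κ < 1) :
    ellipticE (2 * √κ / (1 + κ)) =
      (2 * ellipticE κ - (1 - κ ^ 2) * ellipticK κ) / (1 + κ) := by
  have hκ : |κ| < 1 := abs_lt.2 ⟨by linarith, hκ₁⟩
  have hcont := continuous_one_div_ellipticDelta hκ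
  have hintegrand (φ : ℝ) : (ellipticDelta κ φ + κ * cos φ) / (1 + κ) *
      ((ellipticDelta κ φ + κ * cos φ) / ellipticDelta κ φ) =
        (1 + κ)⁻¹ * (2 * ellipticDelta κ φ + 2 * κ * cos φ
          - (1 - κ ^ 2) * (1 / ellipticDelta κ φ)) := by
    have := (ellipticDelta_pos hκ φ).ne'
    have : 1 + κ ≠ 0 := by linarith
    field_simp
    linear_combination κ ^ 2 * sin_sq_add_cos_sq φ - ellipticDelta_sq hκ φ
  have hfold (φ : ℝ) : 2 * ellipticDelta κ φ + 2 * κ * cos φ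
        - (1 - κ ^ 2) * (1 / ellipticDelta κ φ)
      + (2 * ellipticDelta κ (π - φ) + 2 * κ * cos (π - φ)
        - (1 - κ ^ 2) * (1 / ellipticDelta κ (π - φ))) =
        4 * ellipticDelta κ φ - 2 * (1 - κ ^ 2) * (1 / ellipticDelta κ φ) := by
    rw [ellipticDelta_pi_sub, cos_pi_sub]
    ring
  rw [ellipticE_eq_integral, integral_comp_ellipticDelta_landen hκ₀ hκ₁ fun x => x]
  simp only [hintegrand]
  rw [intervalIntegral.integral_const_mul, integral_zero_eq_integral_add_reflect (by fun_prop)]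
  simp only [hfold]
  rw [intervalIntegral.integral_sub (Continuous.intervalIntegrable (by fun_prop) _ _)
    (Continuous.intervalIntegrable (by fun_prop) _ _)]
  simp only [intervalIntegral.integral_const_mul, ← ellipticK_eq_integral, ← ellipticE_eq_integral]
  ring

lemma integral_ellipticDelta_cube (hκ : |κ| < 1) :
    3 * ∫ φ in (0 : ℝ)..(π / 2), ellipticDelta κ φ ^ 3 =
      2 * (2 - κ ^ 2) * ellipticE κ - (1 - κ ^ 2) * ellipticK κ := by
  -- Integrate the derivative of `κ² sin φ cos φ Δ(κ, φ)`, which vanishes at both endpoints.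
  have hcont := continuous_one_div_ellipticDelta hκ
  have hderiv (φ : ℝ) : HasDerivAt (fun φ => κ ^ 2 * (sin φ * cos φ * ellipticDelta κ φ))
      (3 * ellipticDelta κ φ ^ 3 - 2 * (2 - κ ^ 2) * ellipticDelta κ φ
        + (1 - κ ^ 2) * (1 / ellipticDelta κ φ)) φ := by
    refine ((((hasDerivAt_sin φ).mul (hasDerivAt_cos φ)).mul
      (hasDerivAt_ellipticDelta hκ φ)).const_mul (κ ^ 2)).congr_deriv ?_
    have := (ellipticDelta_pos hκ φ).ne'
    simp only [Pi.mul_apply]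
    field_simp
    rw [cos_sq', ellipticDelta_sq hκ]
    ring
  have hzero := intervalIntegral.integral_eq_sub_of_hasDerivAt (a := 0) (b := π / 2)
    (fun φ _ => hderiv φ) (Continuous.intervalIntegrable (by fun_prop) _ _)
  rw [intervalIntegral.integral_add (Continuous.intervalIntegrable (by fun_prop) _ _)
      (Continuous.intervalIntegrable (by fun_prop) _ _),
    intervalIntegral.integral_sub (Continuous.intervalIntegrable (by fun_prop) _ _)
      (Continuous.intervalIntegrable (by fun_prop) _ _)] at hzero
  simp only [intervalIntegral.integral_const_mul, ← ellipticK_eq_integral, ← ellipticE_eq_integral,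
    sin_zero, cos_pi_div_two] at hzero
  linarith

end Elliptic

/-! ### Coordinates in which the flow is a rotation -/

/-- The negative solution `x` of `x - x⁻¹ = 2 u`. -/
noncomputable def abscissa (u : ℝ) : ℝ := -exp (-arsinh u)

lemma abscissa_neg (u : ℝ) : abscissa u < 0 := neg_lt_zero.2 (exp_pos _)

lemma inv_abscissa (u : ℝ) : (abscissa u)⁻¹ = abscissa (-u) := by
  rw [abscissa, abscissa, inv_neg, ← exp_neg, arsinh_neg]

lemma abscissa_sub_inv (u : ℝ) : abscissa u - (abscissa u)⁻¹ = 2 * u := by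
  have hsinh := sinh_arsinh u
  rw [sinh_eq] at hsinh
  rw [inv_abscissa, abscissa, abscissa, arsinh_neg, neg_neg]
  linarith

lemma abscissa_add_inv (u : ℝ) : abscissa u + (abscissa u)⁻¹ = -(2 * √(1 + u ^ 2)) := by
  have hcosh := cosh_arsinh u
  rw [cosh_eq] at hcosh
  rw [inv_abscissa, abscissa, abscissa, arsinh_neg, neg_neg]
  linarith

lemma abscissa_sub_inv_div_two {x : ℝ} (hx : x < 0) : abscissa ((x - x⁻¹) / 2) = x := by
  have hsinh : (x - x⁻¹) / 2 = sinh (-log (-x)) := by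
    rw [sinh_neg, sinh_log (neg_pos.2 hx), inv_neg]
    ring
  rw [hsinh, abscissa, arsinh_sinh, neg_neg, exp_log (neg_pos.2 hx), neg_neg]

lemma sqrt_one_add_sq_eq_abscissa (u : ℝ) :
    √(1 + u ^ 2) = -(abscissa u ^ 2 + 1) / (2 * abscissa u) := by
  have := (abscissa_neg u).ne
  have hadd := abscissa_add_inv u
  field_simp at hadd ⊢
  linarith

lemma hasDerivAt_abscissa (u : ℝ) :
    HasDerivAt abscissa (2 * abscissa u ^ 2 / (abscissa u ^ 2 + 1)) u := by
  refine (hasDerivAt_arsinh u).neg.exp.neg.congr_deriv ?_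
  have := (abscissa_neg u).ne
  have : abscissa u ^ 2 + 1 ≠ 0 := by positivity
  have hexp : exp (-arsinh u) = -abscissa u := (neg_neg _).symm
  rw [Pi.neg_apply, hexp, sqrt_one_add_sq_eq_abscissa]
  field_simp

/-- A chart of the half plane `x < 0` in which `4 H` is the squared modulus and the orbits `Γ_h` are
circles about `0`. -/
noncomputable def rotationChart : PartialEquiv (ℝ × ℝ) ℂ where
  toFun p := ⟨(p.1 - p.1⁻¹) / 2, p.2 * (1 - p.1⁻¹)⟩
  invFun z := (abscissa z.re, z.im / (1 - (abscissa z.re)⁻¹))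
  source := {p | p.1 < 0}
  target := univ
  map_source' _ _ := mem_univ _
  map_target' z _ := abscissa_neg z.re
  left_inv' p hp := by
    have hpos : 0 < 1 - p.1⁻¹ := by linarith [inv_lt_zero.2 (mem_ofPred.1 hp)]
    simp only [abscissa_sub_inv_div_two hp, mul_div_cancel_right₀ _ hpos.ne']
  right_inv' z _ := by
    have hpos : 0 < 1 - (abscissa z.re)⁻¹ := by linarith [inv_lt_zero.2 (abscissa_neg z.re)]
    simp only [abscissa_sub_inv, mul_div_cancel_left₀ _ (two_ne_zero' ℝ),
      div_mul_cancel₀ _ hpos.ne']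

lemma contDiffOn_rotationChart : ContDiffOn ℝ 1 rotationChart {p | p.1 < 0} := by
  have hinv : ContDiffOn ℝ 1 (fun p : ℝ × ℝ => p.1⁻¹) {p | p.1 < 0} :=
    contDiff_fst.contDiffOn.inv fun p hp => (mem_ofPred.1 hp).ne
  exact Complex.equivRealProdCLM.symm.contDiff.comp_contDiffOn
    (((contDiff_fst.contDiffOn.sub hinv).div_const 2).prodMk
      (contDiff_snd.contDiffOn.mul (contDiffOn_const.sub hinv)))

lemma four_mul_firstIntegral {p : ℝ × ℝ} (hp : p.1 < 0) :
    4 * firstIntegral p = ‖rotationChart p‖ ^ 2 := by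
  have := hp.ne
  rw [Complex.sq_norm, Complex.normSq_apply, firstIntegral]
  simp only [rotationChart]
  field_simp
  ring

lemma mem_orbit_iff {h : ℝ} (hh : 0 ≤ h) {p : ℝ × ℝ} :
    p ∈ orbit h ↔ p.1 < 0 ∧ ‖rotationChart p‖ = 2 * √h := by
  refine and_congr_right fun hp => ?_
  rw [← sq_eq_sq₀ (norm_nonneg _) (by positivity), ← four_mul_firstIntegral hp, mul_pow,
    Real.sq_sqrt hh]
  constructor <;> intro <;> linarith

lemma hasDerivWithinAt_rotationChart_comp {γ : ℝ → ℝ × ℝ} {s : Set ℝ} {t c : ℝ}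
    (hγ : HasDerivWithinAt γ (c • vectorField (γ t)) s t) (hneg : (γ t).1 < 0) :
    HasDerivWithinAt (fun t => rotationChart (γ t))
      ((c * ((γ t).1 ^ 2 + 1) / 2) • (Complex.I * rotationChart (γ t))) s t := by
  have hne := hneg.ne
  have hx : HasDerivWithinAt (fun t => (γ t).1) (c • vectorField (γ t)).1 s t := hγ.fst
  have hy : HasDerivWithinAt (fun t => (γ t).2) (c • vectorField (γ t)).2 s t := hγ.snd
  have hre := (hx.sub (hx.inv hne)).div_const 2
  have him := hy.mul ((hx.inv hne).const_sub 1)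
  refine (Complex.equivRealProdCLM.symm.hasFDerivAt.comp_hasDerivWithinAt t
    (hre.prodMk him)).congr_deriv ?_
  apply Complex.ext
  · simp only [rotationChart, vectorField, Prod.smul_mk, smul_eq_mul, Pi.inv_apply,
      Complex.smul_re, Complex.I_mul_re, ContinuousLinearEquiv.coe_coe,
      Complex.equivRealProdCLM_symm_apply_re]
    field_simp
    ring
  · simp only [rotationChart, vectorField, Prod.smul_mk, smul_eq_mul, Pi.inv_apply,
      Complex.smul_im, Complex.I_mul_im, ContinuousLinearEquiv.coe_coe,
      Complex.equivRealProdCLM_symm_apply_im]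
    field_simp
    ring

lemma hasDerivAt_rotationChart_symm_comp {z : ℝ → ℂ} {t : ℝ}
    (hz : HasDerivAt z (Complex.I * z t) t) :
    HasDerivAt (fun t => rotationChart.symm (z t))
      ((2 / ((rotationChart.symm (z t)).1 ^ 2 + 1)) •
        vectorField (rotationChart.symm (z t))) t := by
  have hre : HasDerivAt (fun t => (z t).re) (-(z t).im) t := by
    exact (Complex.reCLM.hasFDerivAt.comp_hasDerivAt t hz).congr_deriv (by simp)
  have him : HasDerivAt (fun t => (z t).im) (z t).re t := by
    exact (Complex.imCLM.hasFDerivAt.comp_hasDerivAt t hz).congr_deriv (by simp)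
  have hx : HasDerivAt (fun t => abscissa (z t).re) _ t := (hasDerivAt_abscissa _).comp t hre
  have hneg := abscissa_neg (z t).re
  have hpos : 0 < 1 - (abscissa (z t).re)⁻¹ := by linarith [inv_lt_zero.2 hneg]
  refine (hx.prodMk (him.div ((hx.inv hneg.ne).const_sub 1) hpos.ne')).congr_deriv ?_
  have hsub : (z t).re = (abscissa (z t).re - (abscissa (z t).re)⁻¹) / 2 := by
    rw [abscissa_sub_inv, mul_div_cancel_left₀ _ two_ne_zero]
  simp only [rotationChart, vectorField, PartialEquiv.coe_symm_mk, Prod.smul_mk, smul_eq_mul,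
    Pi.inv_apply]
  generalize abscissa (z t).re = x at *
  rw [hsub]
  have : x ≠ 0 := hneg.ne
  have : x - 1 ≠ 0 := by linarith
  have : x ^ 2 + 1 ≠ 0 := by positivity
  ext <;> (field_simp; ring)

/-- The point of `Γ_h` at the angle `θ` of the circle that represents `Γ_h` in `rotationChart`. -/
noncomputable def orbitPoint (h θ : ℝ) : ℝ × ℝ := rotationChart.symm (circleMap 0 (2 * √h) θ)

lemma orbitPoint_fst (h θ : ℝ) : (orbitPoint h θ).1 = abscissa (2 * √h * cos θ) := by
  simp [orbitPoint, rotationChart, circleMap_zero_re]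

lemma orbitPoint_fst_neg (h θ : ℝ) : (orbitPoint h θ).1 < 0 :=
  rotationChart.map_target (mem_univ _)

lemma rotationChart_orbitPoint (h θ : ℝ) :
    rotationChart (orbitPoint h θ) = circleMap 0 (2 * √h) θ :=
  rotationChart.right_inv (mem_univ _)

lemma orbitPoint_snd (h θ : ℝ) :
    (orbitPoint h θ).2 = 2 * √h * sin θ / (1 - (orbitPoint h θ).1⁻¹) := by
  simp [orbitPoint, rotationChart, circleMap_zero_im]

lemma hasDerivAt_orbitPoint (h θ : ℝ) :
    HasDerivAt (orbitPoint h)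
      ((2 / ((orbitPoint h θ).1 ^ 2 + 1)) • vectorField (orbitPoint h θ)) θ :=
  hasDerivAt_rotationChart_symm_comp (by simpa only [mul_comm] using hasDerivAt_circleMap 0 _ θ)

lemma deriv_orbitPoint (h θ : ℝ) :
    deriv (orbitPoint h) θ =
      (2 / ((orbitPoint h θ).1 ^ 2 + 1)) • vectorField (orbitPoint h θ) :=
  (hasDerivAt_orbitPoint h θ).deriv

lemma orbitPoint_periodic (h : ℝ) : Function.Periodic (orbitPoint h) (2 * π) := fun θ => by
  rw [orbitPoint, periodic_circleMap, orbitPoint]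

lemma contDiff_orbitPoint (h : ℝ) : ContDiff ℝ 1 (orbitPoint h) := by
  have hcont : Continuous (orbitPoint h) :=
    continuous_iff_continuousAt.2 fun θ => (hasDerivAt_orbitPoint h θ).continuousAt
  rw [contDiff_one_iff_deriv, funext (deriv_orbitPoint h)]
  refine ⟨fun θ => (hasDerivAt_orbitPoint h θ).differentiableAt, ?_⟩
  have hfield : Continuous vectorField := by
    unfold vectorField
    fun_prop
  have hspeed : Continuous fun θ => 2 / ((orbitPoint h θ).1 ^ 2 + 1) :=
    continuous_const.div ((hcont.fst.pow 2).add_const 1) fun θ => by positivity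
  exact hspeed.smul (hfield.comp hcont)

lemma injOn_orbitPoint {h : ℝ} (hh : 0 < h) (α : ℝ) :
    InjOn (orbitPoint h) (Ico α (α + 2 * π)) := by
  intro θ hθ φ hφ heq
  refine injOn_circleMap_of_abs_sub_le' (c := 0) (R := 2 * √h) (by positivity) (by simp) hθ hφ ?_
  rw [← rotationChart_orbitPoint, heq, rotationChart_orbitPoint]

lemma range_orbitPoint {h : ℝ} (hh : 0 ≤ h) : range (orbitPoint h) = orbit h := by
  ext p
  rw [mem_orbit_iff hh]
  constructor
  · rintro ⟨θ, rfl⟩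
    refine ⟨orbitPoint_fst_neg h θ, ?_⟩
    rw [rotationChart_orbitPoint, norm_circleMap_zero, abs_of_nonneg (by positivity)]
  · rintro ⟨hneg, hnorm⟩
    have hmem : rotationChart p ∈ range (circleMap 0 (2 * √h)) := by
      rw [range_circleMap, mem_sphere_zero_iff_norm, hnorm, abs_of_nonneg (by positivity)]
    obtain ⟨θ, hθ⟩ := hmem
    exact ⟨θ, by rw [orbitPoint, hθ, rotationChart.left_inv hneg]⟩

theorem isOrbitParam_orbitPoint {h : ℝ} (hh : 0 < h) :
    IsOrbitParam h 0 (2 * π) (orbitPoint h) where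
  lt := two_pi_pos
  contDiffOn := (contDiff_orbitPoint h).contDiffOn
  closed := by simpa using (orbitPoint_periodic h 0).symm
  injOn := by simpa using injOn_orbitPoint hh 0
  image_eq := by
    rw [← range_orbitPoint hh.le, ← (orbitPoint_periodic h).image_Icc two_pi_pos 0, zero_add]
  flow θ hθ := ⟨2 / ((orbitPoint h θ).1 ^ 2 + 1), by positivity,
    (hasDerivAt_orbitPoint h θ).hasDerivWithinAt.derivWithin (uniqueDiffOn_Icc two_pi_pos θ hθ)⟩

/-! ### The angle along a parametrization -/

lemma exists_hasDerivAt_exp_eq {z : ℝ → ℂ} {a b : ℝ} (hab : a < b)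
    (hz : ContDiffOn ℝ 1 z (Icc a b)) (hne : ∀ t ∈ Icc a b, z t ≠ 0) :
    ∃ L : ℝ → ℂ, ∀ t ∈ Icc a b,
      HasDerivAt L (derivWithin z (Icc a b) t / z t) t ∧ Complex.exp (L t) = z t := by
  have hcont : ContinuousOn (fun t => derivWithin z (Icc a b) t / z t) (Icc a b) :=
    (hz.continuousOn_derivWithin (uniqueDiffOn_Icc hab) le_rfl).div hz.continuousOn hne
  let ρ : ℝ → ℂ := IccExtend hab.le ((Icc a b).domRestrict fun t => derivWithin z (Icc a b) t / z t)
  have hρ : Continuous ρ := hcont.domRestrict.Icc_extend'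
  let L : ℝ → ℂ := fun t => Complex.log (z a) + ∫ s in a..t, ρ s
  have hL (t : ℝ) (ht : t ∈ Icc a b) :
      HasDerivAt L (derivWithin z (Icc a b) t / z t) t := by
    refine ((hρ.integral_hasStrictDerivAt a t).hasDerivAt.const_add _).congr_deriv ?_
    exact IccExtend_of_mem _ _ ht
  have hquot (t : ℝ) (ht : t ∈ Icc a b) :
      HasDerivWithinAt (fun t => Complex.exp (-L t) * z t) 0 (Icc a b) t := by
    have hzt := (hz.differentiableOn one_ne_zero t ht).hasDerivWithinAt
    refine ((hL t ht).hasDerivWithinAt.neg.cexp.mul hzt).congr_deriv ?_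
    have := hne t ht
    simp only [Pi.neg_apply]
    field_simp
    ring
  have hconst := constant_of_derivWithin_zero
    (fun t ht => (hquot t ht).differentiableWithinAt) fun t ht =>
      (hquot t (Ico_subset_Icc_self ht)).derivWithin
        (uniqueDiffOn_Icc hab t (Ico_subset_Icc_self ht))
  refine ⟨L, fun t ht => ⟨hL t ht, ?_⟩⟩
  have hat := hconst t ht
  have hLa : Complex.exp (-L a) * z a = 1 := by
    have := hne a (left_mem_Icc.2 hab.le)
    simp [L, Complex.exp_neg, Complex.exp_log this, this]
  rw [hLa, Complex.exp_neg, inv_mul_eq_one₀ (Complex.exp_ne_zero _)] at hat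
  exact hat

lemma apply_right_eq_apply_left_add_period {X : Type*} {F : ℝ → X} {θ : ℝ → ℝ} {a b c : ℝ}
    (hab : a < b) (hc : 0 < c) (hF : Function.Periodic F c)
    (hFinj : InjOn F (Ico (θ a) (θ a + c))) (hcont : ContinuousOn θ (Icc a b))
    (hmono : StrictMonoOn θ (Icc a b)) (hinj : InjOn (fun t => F (θ t)) (Ico a b))
    (hclosed : F (θ a) = F (θ b)) : θ b = θ a + c := by
  have hlt : θ a < θ b := hmono (left_mem_Icc.2 hab.le) (right_mem_Icc.2 hab.le) hab
  rcases lt_trichotomy (θ b) (θ a + c) with hshort | heq | hlong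
  · exact absurd (hFinj ⟨le_rfl, by linarith⟩ ⟨hlt.le, hshort⟩ hclosed) hlt.ne
  · exact heq
  · obtain ⟨s, hs, hθs⟩ := intermediate_value_Ioo hab.le hcont ⟨by linarith, hlong⟩
    have hreturn : F (θ s) = F (θ a) := by rw [hθs, hF]
    exact absurd (hinj (Ioo_subset_Ico_self hs) (left_mem_Ico.2 hab) hreturn) hs.1.ne'

/-- The density, in the angle, of the form `(x - 1) x^{i-3} y^j dx` along `orbitPoint h`. -/
noncomputable def angularForm (i j : ℕ) (h φ : ℝ) : ℝ :=
  ((orbitPoint h φ).1 - 1) * (orbitPoint h φ).1 ^ ((i : ℤ) - 3) * (orbitPoint h φ).2 ^ j *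
    (deriv (orbitPoint h) φ).1

lemma angularForm_periodic (i j : ℕ) (h : ℝ) : Function.Periodic (angularForm i j h) (2 * π) :=
  fun φ => by simp only [angularForm, deriv_orbitPoint, orbitPoint_periodic h φ]

namespace IsOrbitParam

variable {h a b : ℝ} {γ : ℝ → ℝ × ℝ}

lemma apply_mem (hγ : IsOrbitParam h a b γ) {t : ℝ} (ht : t ∈ Icc a b) : γ t ∈ orbit h :=
  hγ.image_eq ▸ mem_image_of_mem γ ht

lemma exists_angle (hγ : IsOrbitParam h a b γ) (hh : 0 < h) :
    ∃ θ θ' : ℝ → ℝ, ∀ t ∈ Icc a b,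
      HasDerivAt θ (θ' t) t ∧ 0 < θ' t ∧ γ t = orbitPoint h (θ t) := by
  have hr : 0 < 2 * √h := by positivity
  have hneg (t : ℝ) (ht : t ∈ Icc a b) : (γ t).1 < 0 := (hγ.apply_mem ht).1
  have hnorm (t : ℝ) (ht : t ∈ Icc a b) : ‖rotationChart (γ t)‖ = 2 * √h :=
    ((mem_orbit_iff hh.le).1 (hγ.apply_mem ht)).2
  have hne (t : ℝ) (ht : t ∈ Icc a b) : rotationChart (γ t) ≠ 0 :=
    norm_pos_iff.1 (hnorm t ht ▸ hr)
  obtain ⟨L, hL⟩ := exists_hasDerivAt_exp_eq hγ.lt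
    (contDiffOn_rotationChart.comp hγ.contDiffOn hneg) hne
  choose! c hc hflow using hγ.flow
  refine ⟨fun t => (L t).im, fun t => c t * ((γ t).1 ^ 2 + 1) / 2, fun t ht => ⟨?_, ?_, ?_⟩⟩
  · have hγt := (hγ.contDiffOn.differentiableOn one_ne_zero t ht).hasDerivWithinAt
    rw [hflow t ht] at hγt
    have hz := (hasDerivWithinAt_rotationChart_comp hγt (hneg t ht)).derivWithin
      (uniqueDiffOn_Icc hγ.lt t ht)
    refine (Complex.imCLM.hasFDerivAt.comp_hasDerivAt t (hL t ht).1).congr_deriv ?_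
    have hquot : derivWithin (rotationChart ∘ γ) (Icc a b) t / (rotationChart ∘ γ) t =
        (c t * ((γ t).1 ^ 2 + 1) / 2) • Complex.I := by
      rw [Function.comp_apply, div_eq_iff (hne t ht), smul_mul_assoc]
      exact hz
    rw [hquot]
    simp only [Complex.imCLM_apply, Complex.smul_im, Complex.I_im, smul_eq_mul, mul_one]
  · have := hc t ht
    positivity
  · have hpolar : rotationChart (γ t) = circleMap 0 (2 * √h) (L t).im := by
      have hexp := (hL t ht).2
      have hre : Real.exp (L t).re = 2 * √h := by
        rw [← hnorm t ht, ← Complex.norm_exp, hexp, Function.comp_apply]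
      rw [circleMap_zero, ← hre, Complex.ofReal_exp, ← Complex.exp_add, Complex.re_add_im, hexp,
        Function.comp_apply]
    rw [orbitPoint, ← hpolar, rotationChart.left_inv (hneg t ht)]

lemma angle_right_eq (hγ : IsOrbitParam h a b γ) (hh : 0 < h) {θ θ' : ℝ → ℝ}
    (hθ : ∀ t ∈ Icc a b, HasDerivAt θ (θ' t) t ∧ 0 < θ' t ∧ γ t = orbitPoint h (θ t)) :
    θ b = θ a + 2 * π := by
  have hcont : ContinuousOn θ (Icc a b) := fun t ht => (hθ t ht).1.continuousAt.continuousWithinAt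
  have hmono : StrictMonoOn θ (Icc a b) :=
    strictMonoOn_of_deriv_pos (convex_Icc a b) hcont fun t ht => by
      obtain ⟨hderiv, hpos, -⟩ := hθ t (interior_subset ht)
      rwa [hderiv.deriv]
  refine apply_right_eq_apply_left_add_period hγ.lt two_pi_pos (orbitPoint_periodic h)
    (injOn_orbitPoint hh _) hcont hmono ?_ ?_
  · exact hγ.injOn.congr fun t ht => (hθ t (Ico_subset_Icc_self ht)).2.2
  · rw [← (hθ a (left_mem_Icc.2 hγ.lt.le)).2.2, ← (hθ b (right_mem_Icc.2 hγ.lt.le)).2.2,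
      hγ.closed]

theorem orbitIntegral_eq_integral_angularForm (hγ : IsOrbitParam h a b γ) (hh : 0 < h)
    (i j : ℕ) :
    orbitIntegral i j a b γ = ∫ φ in (0 : ℝ)..(2 * π), angularForm i j h φ := by
  obtain ⟨θ, θ', hθ⟩ := hγ.exists_angle hh
  have hderiv (t : ℝ) (ht : t ∈ Icc a b) :
      derivWithin γ (Icc a b) t = θ' t • deriv (orbitPoint h) (θ t) := by
    rw [derivWithin_congr (fun s hs => (hθ s hs).2.2) (hθ t ht).2.2]
    exact ((hasDerivAt_orbitPoint h (θ t)).differentiableAt.hasDerivAt.scomp t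
      (hθ t ht).1).hasDerivWithinAt.derivWithin (uniqueDiffOn_Icc hγ.lt t ht)
  have hpullback (t : ℝ) (ht : t ∈ Icc a b) :
      ((γ t).1 - 1) * (γ t).1 ^ ((i : ℤ) - 3) * (γ t).2 ^ j * (derivWithin γ (Icc a b) t).1 =
        (angularForm i j h ∘ θ) t * θ' t := by
    rw [hderiv t ht, (hθ t ht).2.2, Prod.smul_fst, smul_eq_mul, Function.comp_apply, angularForm]
    ring
  have hIcc : uIcc a b = Icc a b := uIcc_of_le hγ.lt.le
  have hIoo : Ioo (min a b) (max a b) ⊆ Icc a b := hIcc ▸ Ioo_subset_Icc_self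
  calc orbitIntegral i j a b γ
      = ∫ t in a..b, (angularForm i j h ∘ θ) t * θ' t :=
        intervalIntegral.integral_congr fun t ht => hpullback t (hIcc ▸ ht)
    _ = ∫ φ in θ a..θ b, angularForm i j h φ :=
        intervalIntegral.integral_comp_mul_deriv_of_deriv_nonneg
          (hIcc ▸ fun t ht => (hθ t ht).1.continuousAt.continuousWithinAt)
          (fun t ht => (hθ t (hIoo ht)).1) fun t ht => (hθ t (hIoo ht)).2.1.le
    _ = ∫ φ in (0 : ℝ)..(2 * π), angularForm i j h φ := by
        rw [hγ.angle_right_eq hh hθ, (angularForm_periodic i j h).intervalIntegral_add_eq (θ a) 0,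
          zero_add]

end IsOrbitParam

/-! ### Reduction to elliptic integrals -/

section OrbitIntegrals

variable {h : ℝ}

lemma angularForm_one (hh : 0 ≤ h) (i : ℕ) (φ : ℝ) :
    angularForm i 1 h φ = 4 * h * sin φ ^ 2 * abscissa (2 * √h * cos φ) ^ ((i : ℤ) - 1) /
      √(1 + (2 * √h * cos φ) ^ 2) := by
  have hsqrt := sqrt_one_add_sq_eq_abscissa (2 * √h * cos φ)
  have hneg := abscissa_neg (2 * √h * cos φ)
  rw [angularForm, deriv_orbitPoint, vectorField, orbitPoint_snd, orbitPoint_fst,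
    hsqrt]
  generalize abscissa (2 * √h * cos φ) = x at *
  have hx : x ≠ 0 := hneg.ne
  have : x - 1 ≠ 0 := by linarith
  have : x ^ 2 + 1 ≠ 0 := by positivity
  rw [zpow_sub₀ hx, zpow_sub₀ hx]
  simp only [Prod.smul_mk, smul_eq_mul, pow_one, zpow_natCast, zpow_ofNat]
  field_simp
  rw [Real.sq_sqrt hh]
  ring

lemma continuous_angularForm (i j : ℕ) (h : ℝ) : Continuous (angularForm i j h) := by
  have hpoint := (contDiff_orbitPoint h).continuous
  have hderiv : Continuous (deriv (orbitPoint h)) := (contDiff_orbitPoint h).continuous_deriv le_rfl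
  exact (((hpoint.fst.sub continuous_const).mul (hpoint.fst.zpow₀ _ fun φ =>
    Or.inl (orbitPoint_fst_neg h φ).ne)).mul (hpoint.snd.pow j)).mul hderiv.fst

lemma integral_angularForm_one (hh : 0 ≤ h) (i : ℕ) :
    ∫ φ in (0 : ℝ)..(2 * π), angularForm i 1 h φ =
      2 * ∫ φ in (0 : ℝ)..(π / 2), 4 * h * sin φ ^ 2 *
        (abscissa (2 * √h * cos φ) ^ ((i : ℤ) - 1) + abscissa (2 * √h * cos φ) ^ (1 - (i : ℤ))) /
          √(1 + (2 * √h * cos φ) ^ 2) := by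
  have hcont := continuous_angularForm i 1 h
  have hreflect (φ : ℝ) : angularForm i 1 h (2 * π - φ) = angularForm i 1 h φ := by
    simp only [angularForm_one hh, sin_two_pi_sub, cos_two_pi_sub, neg_sq]
  have hfold (φ : ℝ) : angularForm i 1 h φ + angularForm i 1 h (π - φ) =
      4 * h * sin φ ^ 2 *
        (abscissa (2 * √h * cos φ) ^ ((i : ℤ) - 1) + abscissa (2 * √h * cos φ) ^ (1 - (i : ℤ))) /
          √(1 + (2 * √h * cos φ) ^ 2) := by
    rw [angularForm_one hh, angularForm_one hh, sin_pi_sub, cos_pi_sub, mul_neg, neg_sq,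
      ← inv_abscissa, inv_zpow', neg_sub]
    ring
  rw [integral_zero_eq_integral_add_reflect hcont, mul_div_cancel_left₀ _ two_ne_zero]
  simp only [hreflect, ← two_mul, intervalIntegral.integral_const_mul]
  rw [integral_zero_eq_integral_add_reflect hcont]
  simp only [hfold]

lemma integral_sin_sq_zero_pi_div_two : ∫ φ in (0 : ℝ)..(π / 2), sin φ ^ 2 = π / 4 := by
  rw [integral_sin_sq, sin_zero, cos_pi_div_two]
  ring

lemma integral_sin_sq_mul_abscissa_add_inv (c r : ℝ) :
    ∫ φ in (0 : ℝ)..(π / 2), c * sin φ ^ 2 * (abscissa (r * cos φ) + (abscissa (r * cos φ))⁻¹) /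
      √(1 + (r * cos φ) ^ 2) = -(c * π / 2) := by
  have hintegrand (φ : ℝ) : c * sin φ ^ 2 * (abscissa (r * cos φ) + (abscissa (r * cos φ))⁻¹) /
      √(1 + (r * cos φ) ^ 2) = -(2 * c) * sin φ ^ 2 := by
    have : √(1 + (r * cos φ) ^ 2) ≠ 0 := by positivity
    rw [abscissa_add_inv]
    field_simp
  simp only [hintegrand, intervalIntegral.integral_const_mul, integral_sin_sq_zero_pi_div_two]
  ring

lemma integral_angularForm_zero_one (hh : 0 ≤ h) :
    ∫ φ in (0 : ℝ)..(2 * π), angularForm 0 1 h φ = -4 * π * h := by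
  simp only [integral_angularForm_one hh, Nat.cast_zero, zero_sub, sub_zero, zpow_neg_one, zpow_one]
  simp only [add_comm (_)⁻¹, integral_sin_sq_mul_abscissa_add_inv]
  ring

lemma integral_angularForm_two_one (hh : 0 ≤ h) :
    ∫ φ in (0 : ℝ)..(2 * π), angularForm 2 1 h φ = -4 * π * h := by
  have hsub : (2 : ℤ) - 1 = 1 ∧ 1 - (2 : ℤ) = -1 := by norm_num
  simp only [integral_angularForm_one hh, Nat.cast_ofNat, hsub, zpow_neg_one, zpow_one,
    integral_sin_sq_mul_abscissa_add_inv]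
  ring

/-- The modulus `κ = 2√h / √(4h + 1)` in terms of which `R(φ) = √(1 + 4h cos² φ)` is
`√(4h + 1) Δ(κ, φ)`. The modulus `k(h)` is its image `2√κ / (1 + κ)` under Landen's
transformation. -/
noncomputable def landenModulus (h : ℝ) : ℝ := 2 * √h / √(4 * h + 1)

lemma landenModulus_nonneg (h : ℝ) : 0 ≤ landenModulus h := by
  unfold landenModulus
  positivity

lemma two_mul_sqrt_lt (hh : 0 ≤ h) : 2 * √h < √(4 * h + 1) := by
  refine lt_sqrt_of_sq_lt ?_
  rw [mul_pow, Real.sq_sqrt hh]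
  linarith

lemma landenModulus_lt_one (hh : 0 ≤ h) : landenModulus h < 1 :=
  (div_lt_one (by positivity)).2 (two_mul_sqrt_lt hh)

lemma abs_landenModulus_lt_one (hh : 0 ≤ h) : |landenModulus h| < 1 := by
  rw [abs_of_nonneg (landenModulus_nonneg h)]
  exact landenModulus_lt_one hh

lemma landenModulus_sq (hh : 0 ≤ h) : landenModulus h ^ 2 = 4 * h / (4 * h + 1) := by
  rw [landenModulus, div_pow, mul_pow, Real.sq_sqrt hh, Real.sq_sqrt (by positivity)]
  norm_num

lemma sqrt_one_add_sq_eq_mul_ellipticDelta (hh : 0 ≤ h) (φ : ℝ) :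
    √(1 + (2 * √h * cos φ) ^ 2) = √(4 * h + 1) * ellipticDelta (landenModulus h) φ := by
  rw [ellipticDelta, ← Real.sqrt_mul (by positivity), landenModulus_sq hh, mul_pow, mul_pow,
    Real.sq_sqrt hh, cos_sq']
  congr 1
  field_simp
  ring

lemma mul_sin_sq_eq (hh : 0 ≤ h) (φ : ℝ) :
    4 * h * sin φ ^ 2 = (4 * h + 1) * (1 - ellipticDelta (landenModulus h) φ ^ 2) := by
  rw [ellipticDelta_sq (abs_landenModulus_lt_one hh), landenModulus_sq hh]
  field_simp
  ring

lemma integral_angularForm_one_one (hh : 0 ≤ h) :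
    ∫ φ in (0 : ℝ)..(2 * π), angularForm 1 1 h φ =
      4 * √(4 * h + 1) * (ellipticK (landenModulus h) - ellipticE (landenModulus h)) := by
  have hκ := abs_landenModulus_lt_one hh
  have hcont := continuous_one_div_ellipticDelta hκ
  have hintegrand (φ : ℝ) : 4 * h * sin φ ^ 2 * (1 + 1) / √(1 + (2 * √h * cos φ) ^ 2) =
      2 * √(4 * h + 1) * (1 / ellipticDelta (landenModulus h) φ
        - ellipticDelta (landenModulus h) φ) := by
    have := (ellipticDelta_pos hκ φ).ne'
    rw [sqrt_one_add_sq_eq_mul_ellipticDelta hh]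
    field_simp
    rw [mul_sin_sq_eq hh, Real.sq_sqrt (by positivity)]
    ring
  simp only [integral_angularForm_one hh, Nat.cast_one, sub_self, zpow_zero, hintegrand,
    intervalIntegral.integral_const_mul]
  rw [intervalIntegral.integral_sub (hcont.intervalIntegrable _ _)
    (Continuous.intervalIntegrable (by fun_prop) _ _), ← ellipticK_eq_integral,
    ← ellipticE_eq_integral]
  ring

lemma abscissa_sq_add_inv_sq (u : ℝ) :
    abscissa u ^ 2 + (abscissa u ^ 2)⁻¹ = 4 * √(1 + u ^ 2) ^ 2 - 2 := by
  have := (abscissa_neg u).ne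
  rw [← neg_sq (√(1 + u ^ 2)), show -√(1 + u ^ 2) = (abscissa u + (abscissa u)⁻¹) / 2 by
    rw [abscissa_add_inv]; ring]
  field_simp
  ring

lemma integral_angularForm_three_one (hh : 0 ≤ h) :
    ∫ φ in (0 : ℝ)..(2 * π), angularForm 3 1 h φ =
      4 * √(4 * h + 1) / 3 *
        ((8 * h + 1) * ellipticE (landenModulus h) - ellipticK (landenModulus h)) := by
  have hκ := abs_landenModulus_lt_one hh
  have hcont := continuous_one_div_ellipticDelta hκ
  have hsub : (3 : ℤ) - 1 = 2 ∧ 1 - (3 : ℤ) = -2 := by norm_num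
  have hcube := integral_ellipticDelta_cube hκ
  have hintegrand (φ : ℝ) : 4 * h * sin φ ^ 2 * (4 * √(1 + (2 * √h * cos φ) ^ 2) ^ 2 - 2) /
      √(1 + (2 * √h * cos φ) ^ 2) =
        √(4 * h + 1) * (4 * (4 * h + 1) * (ellipticDelta (landenModulus h) φ
          - ellipticDelta (landenModulus h) φ ^ 3) - 2 * (1 / ellipticDelta (landenModulus h) φ
          - ellipticDelta (landenModulus h) φ)) := by
    have := (ellipticDelta_pos hκ φ).ne'
    rw [sqrt_one_add_sq_eq_mul_ellipticDelta hh]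
    field_simp
    rw [mul_sin_sq_eq hh, Real.sq_sqrt (by positivity)]
  simp only [integral_angularForm_one hh, Nat.cast_ofNat, hsub, zpow_neg, zpow_ofNat,
    abscissa_sq_add_inv_sq, hintegrand, intervalIntegral.integral_const_mul]
  rw [intervalIntegral.integral_sub (Continuous.intervalIntegrable (by fun_prop) _ _)
    (Continuous.intervalIntegrable (by fun_prop) _ _)]
  simp only [intervalIntegral.integral_const_mul]
  rw [intervalIntegral.integral_sub (Continuous.intervalIntegrable (by fun_prop) _ _)
      (Continuous.intervalIntegrable (by fun_prop) _ _),
    intervalIntegral.integral_sub (Continuous.intervalIntegrable (by fun_prop) _ _)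
      (Continuous.intervalIntegrable (by fun_prop) _ _),
    ← ellipticK_eq_integral, ← ellipticE_eq_integral]
  rw [landenModulus_sq hh] at hcube
  field_simp at hcube
  linear_combination -(8 / 3) * √(4 * h + 1) * hcube

lemma sqrt_four_mul_sq_add (hh : 0 ≤ h) : √(4 * h ^ 2 + h) = √(4 * h + 1) * √h := by
  rw [← Real.sqrt_mul (by positivity)]
  congr 1
  ring

lemma sqrt_add_four_mul_sqrt (hh : 0 ≤ h) :
    √(8 * h + 1 + 4 * √(4 * h ^ 2 + h)) = √(4 * h + 1) + 2 * √h := by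
  rw [Real.sqrt_eq_iff_mul_self_eq (by positivity) (by positivity), sqrt_four_mul_sq_add hh]
  linear_combination -(4 * Real.sq_sqrt hh) - Real.sq_sqrt (show 0 ≤ 4 * h + 1 by positivity)

lemma sqrt_sub_four_mul_sqrt (hh : 0 ≤ h) :
    √(8 * h + 1 - 4 * √(4 * h ^ 2 + h)) = √(4 * h + 1) - 2 * √h := by
  rw [Real.sqrt_eq_iff_mul_self_eq_of_pos (sub_pos.2 (two_mul_sqrt_lt hh)),
    sqrt_four_mul_sq_add hh]
  linear_combination 4 * Real.sq_sqrt hh + Real.sq_sqrt (show 0 ≤ 4 * h + 1 by positivity)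

lemma modulus_eq_landen (hh : 0 ≤ h) :
    modulus h = 2 * √(landenModulus h) / (1 + landenModulus h) := by
  have ha : 0 < √(4 * h + 1) := by positivity
  have hsq : 8 * h + 1 + 4 * √(4 * h ^ 2 + h) = (√(4 * h + 1) + 2 * √h) ^ 2 := by
    rw [← sqrt_add_four_mul_sqrt hh, Real.sq_sqrt (by positivity)]
  have hκ : landenModulus h = 2 * (√(4 * h + 1) * √h) / √(4 * h + 1) ^ 2 := by
    rw [landenModulus]
    field_simp
  rw [modulus, hsq, Real.sqrt_div (by positivity), Real.sqrt_sq (by positivity), hκ,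
    Real.sqrt_div (by positivity), Real.sqrt_sq ha.le, Real.sqrt_mul zero_le_two,
    sqrt_four_mul_sq_add hh]
  field_simp

lemma modulus_pos (hh : 0 < h) : 0 < modulus h := by
  unfold modulus
  positivity

lemma modulus_lt_one (hh : 0 ≤ h) : modulus h < 1 := by
  have hsqrt : √(landenModulus h) < 1 := by
    rw [Real.sqrt_lt' one_pos, one_pow]
    exact landenModulus_lt_one hh
  have hκ := landenModulus_nonneg h
  rw [modulus_eq_landen hh, div_lt_one (by positivity)]
  nlinarith [Real.sq_sqrt hκ, sq_pos_of_pos (sub_pos.2 hsqrt)]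

lemma ellipticK_modulus (hh : 0 ≤ h) :
    ellipticK (modulus h) =
      (√(4 * h + 1) + 2 * √h) / √(4 * h + 1) * ellipticK (landenModulus h) := by
  have ha : √(4 * h + 1) ≠ 0 := by positivity
  rw [modulus_eq_landen hh, ellipticK_landen (landenModulus_nonneg h) (landenModulus_lt_one hh),
    landenModulus, one_add_div ha]

lemma sqrt_sub_mul_sqrt_add (hh : 0 ≤ h) :
    (√(4 * h + 1) - 2 * √h) * (√(4 * h + 1) + 2 * √h) = 1 := by
  linear_combination Real.sq_sqrt (show 0 ≤ 4 * h + 1 by positivity) - 4 * Real.sq_sqrt hh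

lemma ellipticE_modulus (hh : 0 ≤ h) :
    ellipticE (modulus h) = (√(4 * h + 1) - 2 * √h) *
      (2 * √(4 * h + 1) * ellipticE (landenModulus h)
        - ellipticK (landenModulus h) / √(4 * h + 1)) := by
  have hsq : √(4 * h + 1) ^ 2 = 4 * h + 1 := Real.sq_sqrt (by positivity)
  have hκ : 1 - landenModulus h ^ 2 = 1 / √(4 * h + 1) ^ 2 := by
    rw [landenModulus_sq hh, hsq]
    field_simp
    ring
  have ha : √(4 * h + 1) ≠ 0 := by positivity
  rw [modulus_eq_landen hh, ellipticE_landen (landenModulus_nonneg h) (landenModulus_lt_one hh),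
    hκ, eq_one_div_of_mul_eq_one_left (sqrt_sub_mul_sqrt_add hh), landenModulus, one_add_div ha]
  field_simp

lemma integral_angularForm_one_one_eq_modulus (hh : 0 ≤ h) :
    ∫ φ in (0 : ℝ)..(2 * π), angularForm 1 1 h φ =
      (16 * h + 2) / √(8 * h + 1 + 4 * √(4 * h ^ 2 + h)) * ellipticK (modulus h)
        - 2 / √(8 * h + 1 - 4 * √(4 * h ^ 2 + h)) * ellipticE (modulus h) := by
  have hpos : √(4 * h + 1) - 2 * √h ≠ 0 := (sub_pos.2 (two_mul_sqrt_lt hh)).ne'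
  rw [integral_angularForm_one_one hh, sqrt_add_four_mul_sqrt hh, sqrt_sub_four_mul_sqrt hh,
    ellipticK_modulus hh, ellipticE_modulus hh]
  field_simp
  rw [Real.sq_sqrt (by positivity)]
  ring

lemma integral_angularForm_three_one_eq_modulus (hh : 0 ≤ h) :
    ∫ φ in (0 : ℝ)..(2 * π), angularForm 3 1 h φ =
      (16 * h + 2) / (3 * √(8 * h + 1 - 4 * √(4 * h ^ 2 + h))) * ellipticE (modulus h)
        - (16 * h + 2 - 8 * √(4 * h ^ 2 + h)) /
            (3 * √(8 * h + 1 - 4 * √(4 * h ^ 2 + h))) * ellipticK (modulus h) := by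
  have hpos : √(4 * h + 1) - 2 * √h ≠ 0 := (sub_pos.2 (two_mul_sqrt_lt hh)).ne'
  have hnum : 16 * h + 2 - 8 * √(4 * h ^ 2 + h) = 2 * (√(4 * h + 1) - 2 * √h) ^ 2 := by
    rw [sqrt_four_mul_sq_add hh]
    linear_combination -2 * Real.sq_sqrt (show 0 ≤ 4 * h + 1 by positivity) - 8 * Real.sq_sqrt hh
  rw [integral_angularForm_three_one hh, hnum, sqrt_sub_four_mul_sqrt hh,
    ellipticK_modulus hh, ellipticE_modulus hh]
  field_simp
  rw [Real.sq_sqrt (by positivity)]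
  linear_combination 2 * ellipticK (landenModulus h) * sqrt_sub_mul_sqrt_add hh

end OrbitIntegrals

theorem lemma2p4 (h : ℝ) (hh : 0 < h) :
    (0 < modulus h ∧ modulus h < 1) ∧
    (∃ (a b : ℝ) (γ : ℝ → ℝ × ℝ), IsOrbitParam h a b γ) ∧
    ∀ (a b : ℝ) (γ : ℝ → ℝ × ℝ), IsOrbitParam h a b γ →
      orbitIntegral 1 1 a b γ =
          (16 * h + 2) / √(8 * h + 1 + 4 * √(4 * h ^ 2 + h)) * ellipticK (modulus h)
          - 2 / √(8 * h + 1 - 4 * √(4 * h ^ 2 + h)) * ellipticE (modulus h) ∧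
      orbitIntegral 3 1 a b γ =
          (16 * h + 2) / (3 * √(8 * h + 1 - 4 * √(4 * h ^ 2 + h))) * ellipticE (modulus h)
          - (16 * h + 2 - 8 * √(4 * h ^ 2 + h)) /
              (3 * √(8 * h + 1 - 4 * √(4 * h ^ 2 + h))) * ellipticK (modulus h) ∧
      orbitIntegral 0 1 a b γ = -4 * π * h ∧
      orbitIntegral 2 1 a b γ = -4 * π * h := by
  refine ⟨⟨modulus_pos hh, modulus_lt_one hh.le⟩,
    ⟨0, 2 * π, orbitPoint h, isOrbitParam_orbitPoint hh⟩, fun a b γ hγ => ?_⟩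
  simp only [hγ.orbitIntegral_eq_integral_angularForm hh]
  exact ⟨integral_angularForm_one_one_eq_modulus hh.le,
    integral_angularForm_three_one_eq_modulus hh.le,
    integral_angularForm_zero_one hh.le, integral_angularForm_two_one hh.le⟩
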